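/- **Performance of $k$-round protocols.** All maps act on the operators of a single qubit. *Devices and protocols.* For every round $j\ge 1$ let $\tilde{\mathcal E}_j$ (sending), $\tilde M_j$ (storage in memory) and $N_j$ (gate noise) be arbitrary qubit channels (completely positive trace-preserving linear maps); their ideal counterparts are the identity channel, and the noisy version of a unitary gate $G$ in round $j$ is $G\circ N_j$, with $N_j$ independent of $G$. For unitary gates $\vec g=(G_1,\dots,G_k)$ the ideal and noisy $k$-round protocols are $$\mathcal P^{k}_{\vec g}=G_k\circ\cdots\circ G_1,\qquad \tilde{\mathcal P}^{k}_{\vec g}=(G_k\circ N_k\circ\tilde M_k\circ\tilde{\mathcal E}_k)\circ\cdots\circ(G_1\circ N_1\circ\tilde M_1\circ\tilde{\mathcal E}_1),$$ where a gate acts as $\rho\mapsto G\rho G^\dagger$. *Test.* Let $\mathsf{Cliff}$ be the single-qubit Clifford group modulo global phases, i.e. the finite set of maps $\rho\mapsto U\rho U^\dagger$ with $U$ unitary normalizing the Pauli group. One execution of the (teleportation-based) ping-pong test at depth $\kappa$ with the same devices is: draw $C_1,\dots,C_\kappa\in\mathsf{Cliff}$ and one of the six Pauli eigenstates $|\psi\rangle$,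 all independently and uniformly; prepare $|\psi\rangle$; run $\tilde{\mathcal T}_\kappa=(C_\kappa\circ N_\kappa\circ\tilde M^{\mathcal T}_\kappa)\circ\cdots\circ(C_1\circ N_1\circ\tilde M^{\mathcal T}_1)$ with $\tilde M_j^{\mathcal T}=\tilde M_j\circ\tilde{\mathcal E}_j$; measure $\{\Pi,\mathbb 1-\Pi\}$ with $\Pi=C_\kappa\circ\cdots\circ C_1(|\psi\rangle\langle\psi|)$, and accept ($v=1$) on the outcome $\Pi$, reject ($v=0$) otherwise. Perform finitely many independent executions at chosen depths. Let $n_k\geq 1$ be the number of executions of depth $k$ and $R_k=\frac1{n_k}\sum_i v^i_k$ the fraction of these that are accepted. *Claim.* For every $\epsilon_k>0$, with probability at least $1-e^{-2n_k\epsilon_k^2}$ over the executions of the test, for all choices of unitary gates $\vec g=(G_1,\dots,G_k)$, $$\big\|\tilde{\mathcal P}^{k}_{\vec g}-\mathcal P^{k}_{\vec g}\big\|_\diamond\le 2\sqrt6\,\sqrt{|\mathsf{Cliff}|^{k}\,(1-R_k+\epsilon_k)},$$ where $\|\tilde\Lambda-\Lambda\|_\diamond=\sup_\rho\|(\tilde\Lambda\otimes\mathbb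 1)(\rho)-(\Lambda\otimes\mathbb 1)(\rho)\|_1$, the supremum being over density operators of the qubit and an auxiliary system of any finite dimension, and $\|\cdot\|_1$ being the trace norm. -/

import Mathlib

open MeasureTheory ProbabilityTheory
open scoped ComplexOrder

noncomputable section

namespace PingPong

/-! ### Qubit operations -/

/-- Operators on one qubit. -/
abbrev QMat : Type := Matrix (Fin 2) (Fin 2) ℂ

/-- Linear maps on the operators of one qubit. -/
abbrev QMap : Type := QMat →ₗ[ℂ] QMat

/-- Operators on a qubit together with an auxiliary system of dimension `m`. -/
abbrev BiMat (m : ℕ) : Type := Matrix (Fin 2 × Fin m) (Fin 2 × Fin m) ℂ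

/-- `(Φ ⊗ id)(ρ)`: the map `Φ` acts on each of the blocks `(1 ⊗ ⟨a|) ρ (1 ⊗ |b⟩)` of `ρ`. -/
def ampl (Φ : QMap) (m : ℕ) (ρ : BiMat m) : BiMat m :=
  Matrix.of fun p q => Φ (Matrix.of fun i j => ρ (i, p.2) (j, q.2)) p.1 q.1

/-- Quantum channels on one qubit: completely positive trace-preserving linear maps. -/
structure QChannel where
  toMap : QMap
  completelyPositive : ∀ (m : ℕ) (ρ : BiMat m), ρ.PosSemidef → (ampl toMap m ρ).PosSemidef
  tracePreserving : ∀ ρ : QMat, (toMap ρ).trace = ρ.trace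

/-- The identity channel. -/
def QChannel.ident : QChannel where
  toMap := LinearMap.id
  completelyPositive := fun _ _ h => h
  tracePreserving := fun _ => rfl

/-- The gate `ρ ↦ U ρ U†` of a matrix `U`. -/
def gate (U : QMat) : QMap where
  toFun ρ := U * ρ * U.conjTranspose
  map_add' ρ τ := by rw [Matrix.mul_add, Matrix.add_mul]
  map_smul' c ρ := by simp

/-! ### Diamond distance -/

/-- The trace norm `‖A‖₁ = Tr √(A†A)`, that is, the sum of the singular values of `A`. -/
def traceNorm {ι : Type*} [Fintype ι] [DecidableEq ι] (A : Matrix ι ι ℂ) : ℝ :=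
  ∑ i, √((Matrix.isHermitian_conjTranspose_mul_self A).eigenvalues i)

/-- `ρ` is a density operator. -/
def IsDensity {ι : Type*} [Fintype ι] (ρ : Matrix ι ι ℂ) : Prop :=
  ρ.PosSemidef ∧ ρ.trace = 1

/-- The diamond distance `sup_ρ ‖(Φ ⊗ id)(ρ) - (Ψ ⊗ id)(ρ)‖₁`, over all density operators `ρ` of the
qubit and an auxiliary system of arbitrary finite dimension. -/
def diamondDist (Φ Ψ : QMap) : ℝ :=
  sSup {x : ℝ | ∃ (m : ℕ) (ρ : BiMat m), IsDensity ρ ∧ x = traceNorm (ampl Φ m ρ - ampl Ψ m ρ)}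

/-! ### Protocols in rounds -/

/-- The devices of the two nodes. In round `j + 1` the qubit is sent by the channel `send j`
and stored by the channel `mem j`, and every gate of that round is preceded by the noise
`gateNoise j`, which does not depend on the gate that is applied. -/
structure Devices where
  send : ℕ → QChannel
  mem : ℕ → QChannel
  gateNoise : ℕ → QChannel

/-- Noiseless devices. -/
def Devices.ideal : Devices where
  send _ := QChannel.ident
  mem _ := QChannel.ident
  gateNoise _ := QChannel.ident

/-- Transmission of the qubit followed by its storage. For teleportation into a memory this is
the effective channel from the teleported state to the recovered one. -/
def Devices.sendAndStore (D : Devices) (j : ℕ) : QMap :=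
  (D.mem j).toMap ∘ₗ (D.send j).toMap

/-- `k` rounds of sending, storing and applying a gate, with the devices `D`; `G j` is the ideal
gate of round `j + 1`, and the gate of the last round is applied last. -/
def rounds (D : Devices) : (k : ℕ) → (Fin k → QMap) → QMap
  | 0, _ => LinearMap.id
  | k + 1, G =>
      G (Fin.last k) ∘ₗ (D.gateNoise k).toMap ∘ₗ D.sendAndStore k ∘ₗ
        rounds D k (fun j => G j.castSucc)

/-- The `k`-round protocol (between preparation and measurement) with unitary gates `U`. -/
def protocol (D : Devices) {k : ℕ} (U : Fin k → Matrix.unitaryGroup (Fin 2) ℂ) : QMap :=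
  rounds D k fun j => gate (U j : QMat)

/-! ### Pauli states and Clifford gates -/

/-- The Pauli matrices `X`, `Y`, `Z`. -/
def pauli : Fin 3 → QMat :=
  ![!![0, 1; 1, 0], !![0, -Complex.I; Complex.I, 0], !![1, 0; 0, -1]]

/-- The Pauli group on one qubit: the matrices `iʳ P` with `P` one of `1`, `X`, `Y`, `Z`. -/
def pauliGroup : Set QMat :=
  {A | ∃ r : Fin 4, A = Complex.I ^ (r : ℕ) • (1 : QMat) ∨
    ∃ a : Fin 3, A = Complex.I ^ (r : ℕ) • pauli a}

/-- The single-qubit Clifford group, as a group of operations (so that global phases are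
disregarded): the maps `ρ ↦ U ρ U†` where the unitary `U` normalizes the Pauli group. -/
def Cliff : Type :=
  {Φ : QMap // ∃ U ∈ Matrix.unitaryGroup (Fin 2) ℂ,
    (∀ A : QMat, A ∈ pauliGroup ↔ U * A * U.conjTranspose ∈ pauliGroup) ∧ Φ = gate U}

/-- The six Pauli states: `pauliState (a, s)` is the projector `|ψ⟩⟨ψ| = (1 ± P) / 2` onto the
eigenstate of the `a`-th Pauli matrix `P` with eigenvalue `1` if `s` is true, and `-1` if not. -/
def pauliState (x : Fin 3 × Bool) : QMat :=
  (1 / 2 : ℂ) • (1 + (if x.2 then (1 : ℂ) else -1) • pauli x.1)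

/-! ### The teleportation-based ping-pong test -/

/-- The record of one execution of the test at depth `κ`: the Clifford gates and the Pauli state
that were chosen, and whether the measurement at the end accepted. -/
structure Execution (κ : ℕ) where
  gates : Fin κ → Cliff
  state : Fin 3 × Bool
  accept : Bool

instance (κ : ℕ) : MeasurableSpace (Execution κ) := ⊤

/-- The element of the final measurement for accepting, `C_κ ∘ ⋯ ∘ C_1 (|ψ⟩⟨ψ|)`, or rejecting,
`1 - C_κ ∘ ⋯ ∘ C_1 (|ψ⟩⟨ψ|)`, the output state. -/
def povm {κ : ℕ} (c : Fin κ → Cliff) (x : Fin 3 × Bool) (accept : Bool) : QMat :=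
  let target := rounds Devices.ideal κ (fun j => (c j).val) (pauliState x)
  if accept then target else 1 - target

/-- The probability of a record: gates and state are uniformly distributed, and the outcome is
obtained by measuring the state that is output when the devices `D` are used. -/
def execProb (D : Devices) {κ : ℕ} (e : Execution κ) : ℝ :=
  1 / (Nat.card Cliff : ℝ) ^ κ * (1 / 6) *
    (rounds D κ (fun j => (e.gates j).val) (pauliState e.state) *
      povm e.gates e.state e.accept).trace.re

/-- `X` is a run of the test with the devices `D`: the executions, the `i`-th of which has depth
`depth i`, are independent, and each of them is distributed as it has to be at its depth. -/
structure IsTestRun {Ω : Type*} [MeasurableSpace Ω] (μ : Measure Ω) (D : Devices) {N : ℕ}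
    (depth : Fin N → ℕ) (X : (i : Fin N) → Ω → Execution (depth i)) : Prop where
  measurable : ∀ i, Measurable (X i)
  indep : iIndepFun X μ
  law : ∀ (i : Fin N) (e : Execution (depth i)), μ.real (X i ⁻¹' {e}) = execProb D e

/-- The number of executions of depth `k`. -/
def numExec {N : ℕ} (depth : Fin N → ℕ) (k : ℕ) : ℕ :=
  (Finset.univ.filter fun i => depth i = k).card

/-- The winning rate at depth `k`: the fraction of accepted ones among the executions of
depth `k`. -/
def winRate {N : ℕ} (depth : Fin N → ℕ) (k : ℕ) (e : (i : Fin N) → Execution (depth i)) : ℝ :=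
  (∑ i ∈ Finset.univ.filter (fun i => depth i = k), if (e i).accept then (1 : ℝ) else 0) /
    numExec depth k

end PingPong

end

open MeasureTheory ProbabilityTheory
open scoped ComplexOrder

noncomputable section

namespace PingPong

/-! ### The trace norm and decompositions into positive parts -/

/-! Let `Λ_j` be the noise of round `j + 1` before its gate and `r_j = pauliCorr Λ_j id`. Averaging
over the Clifford gates twirls each `Λ_j`: on traceless operators only multiplication by `r_j`
survives. The six input states then give an acceptance probability of exactly `(1 + ∏ r_j) / 2` at
depth `k` (`sum_pauliCorr_rounds`, `acceptProb_eq`). By Hoeffding's inequality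
(`measure_winRate_ge_le`), outside an event of probability at most `exp (-2 n ε²)` the failure
probability is below `a = 1 - R + ε`, hence `∏ r_j ≥ 1 - 2a`.

If `6 |Cliff|^k a ≥ 1`, the claimed bound is at least `2` and holds for any two channels. Otherwise
`1 - 2a > 1/3`, and since every `r_j` lies in `[-1/3, 1]`, each single `r_j` is at least `1 - 2a`
(`le_of_le_prod`). As `entFidelity Λ_j = 1 + 3 r_j`, the Choi matrix of `Λ_j` is then close to that
of the identity, so `Λ_j` is within `8 √(3a/2)` of the identity in diamond distance
(`QChannel.diffBound_choi`). The noise does not depend on the gates, so for arbitrary unitaries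
these errors add up to at most `8 k √(3a/2)`. This suffices because `4 k² ≤ 4^k ≤ |Cliff|^k`.

Trace norms are bounded throughout by exhibiting differences of positive matrices (`DiffBound`), a
form which is additive and preserved by channels. -/

/-- `A` is a difference of positive semidefinite matrices whose traces add up to at most `x`. -/
def DiffBound {ι : Type*} [Fintype ι] (A : Matrix ι ι ℂ) (x : ℝ) : Prop :=
  ∃ P N : Matrix ι ι ℂ, P.PosSemidef ∧ N.PosSemidef ∧ A = P - N ∧ (P.trace + N.trace).re ≤ x

theorem DiffBound.mono {ι : Type*} [Fintype ι] {A : Matrix ι ι ℂ} {x y : ℝ}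
    (h : DiffBound A x) (hxy : x ≤ y) : DiffBound A y := by
  obtain ⟨P, N, hP, hN, hA, hx⟩ := h
  exact ⟨P, N, hP, hN, hA, hx.trans hxy⟩

theorem DiffBound.add {ι : Type*} [Fintype ι] {A B : Matrix ι ι ℂ} {x y : ℝ}
    (hA : DiffBound A x) (hB : DiffBound B y) : DiffBound (A + B) (x + y) := by
  obtain ⟨P, N, hP, hN, rfl, hx⟩ := hA
  obtain ⟨P', N', hP', hN', rfl, hy⟩ := hB
  refine ⟨P + P', N + N', hP.add hP', hN.add hN', by abel, ?_⟩
  simp only [Matrix.trace_add, Complex.add_re] at *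
  linarith

theorem diffBound_zero {ι : Type*} [Fintype ι] : DiffBound (0 : Matrix ι ι ℂ) 0 :=
  ⟨0, 0, .zero, .zero, by simp, by simp⟩

/-- Diagonalising `A` shows that the eigenvalues of `A†A` are the squares of those of `A`. The two
lists may be ordered differently, so they are compared as multisets of roots of the characteristic
polynomial. -/
theorem traceNorm_eq_sum_abs_eigenvalues {ι : Type*} [Fintype ι] [DecidableEq ι] {A : Matrix ι ι ℂ}
    (hA : A.IsHermitian) : traceNorm A = ∑ i, |hA.eigenvalues i| := by
  have hB := Matrix.isHermitian_conjTranspose_mul_self A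
  set V := (hA.eigenvectorUnitary : Matrix ι ι ℂ)
  have hV : star V * V = 1 := Unitary.coe_star_mul_self hA.eigenvectorUnitary
  have hspec : A = V * Matrix.diagonal (fun i => (hA.eigenvalues i : ℂ)) * star V := by
    conv_lhs => rw [hA.spectral_theorem, Unitary.conjStarAlgAut_apply]
    rfl
  have hsq : A.conjTranspose * A =
      V * Matrix.diagonal (fun i => ((hA.eigenvalues i ^ 2 : ℝ) : ℂ)) * star V := by
    rw [hA.eq]
    conv_lhs => rw [hspec]
    calc _ = V * (Matrix.diagonal (fun i => (hA.eigenvalues i : ℂ)) * (star V * V) *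
              Matrix.diagonal (fun i => (hA.eigenvalues i : ℂ))) * star V := by
            simp only [Matrix.mul_assoc]
      _ = _ := by
            rw [hV, Matrix.mul_one, Matrix.diagonal_mul_diagonal]
            simp [sq]
  have hchar : (A.conjTranspose * A).charpoly.roots =
      Multiset.map (fun i => ((hA.eigenvalues i ^ 2 : ℝ) : ℂ)) Finset.univ.val := by
    rw [hsq, Matrix.charpoly_mul_comm, ← Matrix.mul_assoc, hV, Matrix.one_mul,
      Matrix.charpoly_diagonal, Polynomial.roots_prod]
    · simp only [Polynomial.roots_X_sub_C, Multiset.bind_singleton]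
    · exact Finset.prod_ne_zero_iff.2 fun i _ => Polynomial.X_sub_C_ne_zero _
  have h := hB.roots_charpoly_eq_eigenvalues
  rw [hchar] at h
  have h2 := congrArg (fun s => (s.map fun z : ℂ => √z.re).sum) h
  simp only [Multiset.map_map, Function.comp_def, Complex.ofReal_re, Real.sqrt_sq_eq_abs] at h2
  exact h2.symm

/-- In an eigenbasis of `A` each eigenvalue is `P i i - N i i`, of absolute value at most `P i i + N
i i`; summing gives the traces. -/
theorem traceNorm_le_of_diffBound {ι : Type*} [Fintype ι] [DecidableEq ι] {A : Matrix ι ι ℂ}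
    {x : ℝ} (h : DiffBound A x) : traceNorm A ≤ x := by
  obtain ⟨P, N, hP, hN, hPN, hx⟩ := h
  have hA : A.IsHermitian := hPN ▸ hP.isHermitian.sub hN.isHermitian
  rw [traceNorm_eq_sum_abs_eigenvalues hA]
  set V := (hA.eigenvectorUnitary : Matrix ι ι ℂ)
  have hV : V * V.conjTranspose = 1 := Unitary.coe_mul_star_self hA.eigenvectorUnitary
  have hV' : V.conjTranspose * V = 1 := Unitary.coe_star_mul_self hA.eigenvectorUnitary
  have hspec : A = V * Matrix.diagonal (fun i => (hA.eigenvalues i : ℂ)) * V.conjTranspose := by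
    conv_lhs => rw [hA.spectral_theorem, Unitary.conjStarAlgAut_apply]
    rfl
  have hdiag : V.conjTranspose * P * V - V.conjTranspose * N * V =
      Matrix.diagonal (fun i => (hA.eigenvalues i : ℂ)) := by
    rw [← Matrix.sub_mul, ← Matrix.mul_sub, ← hPN]
    conv_lhs => rw [hspec]
    calc _ = (V.conjTranspose * V) * Matrix.diagonal (fun i => (hA.eigenvalues i : ℂ)) *
          (V.conjTranspose * V) := by simp only [Matrix.mul_assoc]
      _ = _ := by rw [hV']; simp
  have hPd := hP.conjTranspose_mul_mul_same V
  have hNd := hN.conjTranspose_mul_mul_same V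
  have htr (M : Matrix ι ι ℂ) : (V.conjTranspose * M * V).trace = M.trace := by
    rw [Matrix.trace_mul_comm, ← Matrix.mul_assoc, hV, Matrix.one_mul]
  rw [← htr P, ← htr N] at hx
  refine le_trans ?_ hx
  simp only [Matrix.trace, Matrix.diag, Complex.add_re, Complex.re_sum, ← Finset.sum_add_distrib]
  refine Finset.sum_le_sum fun i _ => ?_
  have h1 := congrArg Complex.re (congrFun (congrFun hdiag i) i)
  have h2 := (Complex.le_def.1 (hPd.diag_nonneg (i := i))).1
  have h3 := (Complex.le_def.1 (hNd.diag_nonneg (i := i))).1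
  simp only [Matrix.sub_apply, Matrix.diagonal_apply_eq, Complex.sub_re, Complex.ofReal_re,
    Complex.zero_re] at h1 h2 h3
  rw [abs_le]
  constructor <;> linarith

/-! ### Channels -/

theorem trace_ampl {Φ : QMap} (hΦ : ∀ ρ : QMat, (Φ ρ).trace = ρ.trace) {m : ℕ}
    (ρ : BiMat m) : (ampl Φ m ρ).trace = ρ.trace := by
  have h (a : Fin m) := hΦ (Matrix.of fun i j => ρ (i, a) (j, a))
  simp only [Matrix.trace, Matrix.diag, Matrix.of_apply, ampl, Fintype.sum_prod_type] at h ⊢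
  rw [Finset.sum_comm, Finset.sum_congr rfl fun a _ => h a, Finset.sum_comm]

theorem ampl_sub (Φ : QMap) {m : ℕ} (ρ τ : BiMat m) :
    ampl Φ m (ρ - τ) = ampl Φ m ρ - ampl Φ m τ := by
  ext p q
  exact congrFun (congrFun (map_sub Φ (Matrix.of fun i j => ρ (i, p.2) (j, q.2))
    (Matrix.of fun i j => τ (i, p.2) (j, q.2))) p.1) q.1

/-- Composition of channels. -/
def QChannel.comp (Φ Ψ : QChannel) : QChannel where
  toMap := Φ.toMap ∘ₗ Ψ.toMap
  completelyPositive m ρ h := Φ.completelyPositive m _ (Ψ.completelyPositive m ρ h)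
  tracePreserving ρ := (Φ.tracePreserving _).trans (Ψ.tracePreserving ρ)

theorem ampl_gate (U : QMat) (m : ℕ) (ρ : BiMat m) :
    ampl (gate U) m ρ = Matrix.kronecker U (1 : Matrix (Fin m) (Fin m) ℂ) * ρ *
      (Matrix.kronecker U (1 : Matrix (Fin m) (Fin m) ℂ)).conjTranspose := by
  ext ⟨i, a⟩ ⟨j, b⟩
  simp [ampl, gate, Matrix.mul_apply, Matrix.kroneckerMap_apply, Fintype.sum_prod_type,
    Matrix.conjTranspose_apply, Matrix.one_apply, Fin.sum_univ_two, apply_ite (starRingEnd ℂ)]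

/-- The gate of a unitary matrix, as a channel. -/
def gateChannel (U : Matrix.unitaryGroup (Fin 2) ℂ) : QChannel where
  toMap := gate U
  completelyPositive m ρ h := by
    rw [ampl_gate]
    exact h.mul_mul_conjTranspose_same _
  tracePreserving ρ := by
    have h : (U : QMat).conjTranspose * U = 1 := Unitary.coe_star_mul_self U
    change ((U : QMat) * ρ * (U : QMat).conjTranspose).trace = _
    rw [Matrix.trace_mul_comm, ← Matrix.mul_assoc, h, Matrix.one_mul]

theorem IsDensity.ampl {m : ℕ} {ρ : BiMat m} (h : IsDensity ρ) (Φ : QChannel) :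
    IsDensity (ampl Φ.toMap m ρ) :=
  ⟨Φ.completelyPositive m ρ h.1, (trace_ampl Φ.tracePreserving ρ).trans h.2⟩

theorem DiffBound.ampl {m : ℕ} {A : BiMat m} {x : ℝ} (h : DiffBound A x) (Φ : QChannel) :
    DiffBound (ampl Φ.toMap m A) x := by
  obtain ⟨P, N, hP, hN, rfl, hx⟩ := h
  refine ⟨_, _, Φ.completelyPositive m P hP, Φ.completelyPositive m N hN, ampl_sub _ _ _, ?_⟩
  rwa [trace_ampl Φ.tracePreserving, trace_ampl Φ.tracePreserving]

/-- The noise of round `j + 1`, up to the ideal gate. -/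
def Devices.noise (D : Devices) (j : ℕ) : QChannel :=
  (D.gateNoise j).comp ((D.mem j).comp (D.send j))

theorem rounds_succ (D : Devices) (k : ℕ) (G : Fin (k + 1) → QMap) :
    rounds D (k + 1) G =
      G (Fin.last k) ∘ₗ (D.noise k).toMap ∘ₗ rounds D k (fun j => G j.castSucc) := rfl

theorem exists_channel_protocol (D : Devices) {k : ℕ} (U : Fin k → Matrix.unitaryGroup (Fin 2) ℂ) :
    ∃ Φ : QChannel, Φ.toMap = protocol D U := by
  induction k with
  | zero => exact ⟨QChannel.ident, rfl⟩
  | succ k ih =>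
    obtain ⟨Φ, hΦ⟩ := ih fun j => U j.castSucc
    refine ⟨(gateChannel (U (Fin.last k))).comp ((D.noise k).comp Φ), ?_⟩
    rw [protocol, rounds_succ]
    simp only [QChannel.comp, hΦ]
    rfl

theorem diffBound_protocol_le_two (D : Devices) {k : ℕ} (U : Fin k → Matrix.unitaryGroup (Fin 2) ℂ)
    {m : ℕ} {ρ : BiMat m} (hρ : IsDensity ρ) :
    DiffBound (ampl (protocol D U) m ρ - ampl (protocol Devices.ideal U) m ρ) 2 := by
  obtain ⟨Φ, hΦ⟩ := exists_channel_protocol D U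
  obtain ⟨Ψ, hΨ⟩ := exists_channel_protocol Devices.ideal U
  rw [← hΦ, ← hΨ]
  refine ⟨_, _, (hρ.ampl Φ).1, (hρ.ampl Ψ).1, rfl, ?_⟩
  rw [(hρ.ampl Φ).2, (hρ.ampl Ψ).2]
  norm_num

/-- Telescoping over rounds: the error of the earlier rounds does not grow under the last noise and
gate, and the last noise adds its own error on the ideal intermediate state. -/
theorem diffBound_protocol_of_noise (D : Devices) {k : ℕ}
    (U : Fin k → Matrix.unitaryGroup (Fin 2) ℂ) {m : ℕ} {x : ℝ}
    (hx : ∀ j < k, ∀ ρ : BiMat m, IsDensity ρ → DiffBound (ampl (D.noise j).toMap m ρ - ρ) x)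
    {ρ : BiMat m} (hρ : IsDensity ρ) :
    DiffBound (ampl (protocol D U) m ρ - ampl (protocol Devices.ideal U) m ρ) (k * x) := by
  induction k with
  | zero => simpa [protocol, rounds] using diffBound_zero
  | succ k ih =>
    have h := ih (fun j => U j.castSucc) fun j hj => hx j (hj.trans (Nat.lt_succ_self k))
    obtain ⟨Ψ, hΨ⟩ := exists_channel_protocol Devices.ideal fun j => U j.castSucc
    have h1 := (h.ampl (D.noise k)).ampl (gateChannel (U (Fin.last k)))
    have h2 := (hx k (Nat.lt_succ_self k) _ (hρ.ampl Ψ)).ampl (gateChannel (U (Fin.last k)))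
    rw [hΨ] at h2
    refine ((h1.add h2).mono (by push_cast; linarith) : DiffBound _ ((k + 1 : ℕ) * x)) |>
      Eq.mp (congrArg (DiffBound · _) ?_)
    simp only [ampl_sub, sub_add_sub_cancel]
    rfl

/-! ### The Choi matrix -/

/-- The unnormalised maximally entangled vector `∑ i, |ii⟩`. -/
def bell : Fin 2 × Fin 2 → ℂ := fun p => if p.1 = p.2 then 1 else 0

theorem star_bell : star bell = bell := by
  ext p
  simp only [bell, Pi.star_apply]
  split_ifs <;> simp

/-- The Choi matrix of a map. -/
def choi (Φ : QMap) : BiMat 2 := ampl Φ 2 (Matrix.vecMulVec bell (star bell))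

theorem choi_apply (Φ : QMap) (i k j l : Fin 2) :
    choi Φ (i, k) (j, l) = Φ (Matrix.single k l 1) i j := by
  have : (Matrix.of fun i j => Matrix.vecMulVec bell (star bell) (i, k) (j, l) : QMat) =
      Matrix.single k l 1 := by
    ext i j
    rw [star_bell]
    simp only [Matrix.of_apply, Matrix.vecMulVec_apply, bell, Matrix.single_apply]
    simp only [eq_comm (a := k), eq_comm (a := l), ite_and, mul_ite, mul_one, mul_zero]
    split_ifs <;> rfl
  simp only [choi, ampl, Matrix.of_apply] at this ⊢
  rw [this]

theorem QChannel.posSemidef_choi (Φ : QChannel) : (choi Φ.toMap).PosSemidef :=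
  Φ.completelyPositive 2 _ (Matrix.posSemidef_vecMulVec_self_star bell)

theorem QChannel.trace_choi (Φ : QChannel) : (choi Φ.toMap).trace = 2 := by
  rw [choi, trace_ampl Φ.tracePreserving, star_bell]
  simp [Matrix.trace, Matrix.vecMulVec_apply, bell, Fintype.sum_prod_type]

/-- The operator that the map with Choi matrix `M` assigns to `ρ`. -/
def ofChoi (M : BiMat 2) {m : ℕ} (ρ : BiMat m) : BiMat m :=
  Matrix.of fun p q => ∑ k, ∑ l, M (p.1, k) (q.1, l) * ρ (k, p.2) (l, q.2)

theorem ampl_eq_ofChoi (Φ : QMap) (m : ℕ) (ρ : BiMat m) : ampl Φ m ρ = ofChoi (choi Φ) ρ := by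
  ext ⟨i, a⟩ ⟨j, b⟩
  simp only [ampl, ofChoi, Matrix.of_apply, choi_apply]
  conv_lhs => rw [Matrix.matrix_eq_sum_single (Matrix.of fun i j => ρ (i, a) (j, b))]
  have h (k l : Fin 2) : (Matrix.single k l (ρ (k, a) (l, b)) : QMat) =
      ρ (k, a) (l, b) • Matrix.single k l 1 := by simp
  simp only [Matrix.of_apply, map_sum, h, map_smul, Matrix.sum_apply, Matrix.smul_apply,
    smul_eq_mul, mul_comm]

theorem ofChoi_sub (M M' : BiMat 2) {m : ℕ} (ρ : BiMat m) :
    ofChoi (M - M') ρ = ofChoi M ρ - ofChoi M' ρ := by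
  ext p q
  simp [ofChoi, sub_mul]

theorem ofChoi_bell {m : ℕ} (ρ : BiMat m) : ofChoi (Matrix.vecMulVec bell bell) ρ = ρ := by
  ext ⟨i, a⟩ ⟨j, b⟩
  simp [ofChoi, Matrix.vecMulVec_apply, bell]

/-- A principal submatrix of `M ⊗ ρ`, with the input index of `M` identified with the qubit index of
`ρ`, is compressed by the matrix `V` that sums over this shared index. -/
theorem posSemidef_ofChoi {M : BiMat 2} (hM : M.PosSemidef) {m : ℕ} {ρ : BiMat m}
    (hρ : ρ.PosSemidef) : (ofChoi M ρ).PosSemidef := by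
  have h := ((hM.kronecker hρ).submatrix
    fun x : Fin 2 × (Fin 2 × Fin m) => ((x.2.1, x.1), (x.1, x.2.2)))
  let V : Matrix (Fin 2 × (Fin 2 × Fin m)) (Fin 2 × Fin m) ℂ :=
    Matrix.of fun x p => if x.2 = p then 1 else 0
  let S : Matrix (Fin 2 × (Fin 2 × Fin m)) (Fin 2 × (Fin 2 × Fin m)) ℂ :=
    Matrix.of fun x y => M (x.2.1, x.1) (y.2.1, y.1) * ρ (x.1, x.2.2) (y.1, y.2.2)
  have e : ofChoi M ρ = V.conjTranspose * S * V := by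
    refine Matrix.ext fun p q => ?_
    have hs (f : Fin 2 × (Fin 2 × Fin m) → ℂ) : ∑ x, f x = ∑ k, ∑ p, f (k, p) :=
      Fintype.sum_prod_type f
    simp only [V, S, ofChoi, Matrix.mul_apply, hs, Matrix.of_apply, Matrix.conjTranspose_apply,
      apply_ite star, star_one, star_zero, ite_mul, one_mul, zero_mul, mul_ite, mul_one, mul_zero,
      Finset.sum_ite_eq', Finset.mem_univ, if_true]
    exact Finset.sum_comm
  rw [e]
  exact Matrix.PosSemidef.conjTranspose_mul_mul_same (A := S) h V

/-- This is `Tr (Aᵀ B) ≤ Tr A · Tr B`. In the qubit case the off-diagonal terms are controlled by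
the two determinants and the arithmetic-geometric mean inequality. -/
theorem re_sum_mul_le {A B : QMat} (hA : A.PosSemidef) (hB : B.PosSemidef) :
    (∑ k, ∑ l, A k l * B k l).re ≤ A.trace.re * B.trace.re := by
  have key {C : QMat} (hC : C.PosSemidef) : 0 ≤ (C 0 0).re ∧ 0 ≤ (C 1 1).re ∧
      (C 0 0).im = 0 ∧ (C 1 1).im = 0 ∧ (C 1 0).re = (C 0 1).re ∧ (C 1 0).im = -(C 0 1).im ∧
      (C 0 1).re ^ 2 + (C 0 1).im ^ 2 ≤ (C 0 0).re * (C 1 1).re := by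
    have h0 := Complex.le_def.1 (hC.diag_nonneg (i := 0))
    have h1 := Complex.le_def.1 (hC.diag_nonneg (i := 1))
    have h2 := hC.isHermitian.apply 1 0
    have h3 := (Complex.le_def.1 hC.det_nonneg).1
    simp only [Complex.zero_re, Complex.zero_im] at h0 h1
    have h4 := congrArg Complex.re h2
    have h5 := congrArg Complex.im h2
    simp only [RCLike.star_def, Complex.conj_re, Complex.conj_im] at h4 h5
    refine ⟨h0.1, h1.1, h0.2.symm, h1.2.symm, h4.symm, by linarith, ?_⟩
    rw [Matrix.det_fin_two] at h3
    simp only [Complex.sub_re, Complex.mul_re, Complex.zero_re, ← h0.2, ← h1.2, ← h4, ← h5] at h3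
    linarith
  obtain ⟨a0, a1, a2, a3, a4, a5, a6⟩ := key hA
  obtain ⟨b0, b1, b2, b3, b4, b5, b6⟩ := key hB
  simp only [Matrix.trace, Matrix.diag, Fin.sum_univ_two, Complex.add_re, Complex.mul_re, a2, a3,
    a4, a5, b2, b3, b4, b5]
  generalize (A 0 0).re = a, (A 1 1).re = d, (A 0 1).re = x, (A 0 1).im = y,
    (B 0 0).re = e, (B 1 1).re = g, (B 0 1).re = z, (B 0 1).im = w at *
  have hcs : (2 * (x * z - y * w)) ^ 2 ≤ (a * g + d * e) ^ 2 := by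
    have h1 : (x * z - y * w) ^ 2 ≤ (x ^ 2 + y ^ 2) * (z ^ 2 + w ^ 2) := by
      nlinarith [sq_nonneg (x * w + y * z)]
    have h2 : (x ^ 2 + y ^ 2) * (z ^ 2 + w ^ 2) ≤ (a * d) * (e * g) :=
      mul_le_mul a6 b6 (by positivity) (by positivity)
    nlinarith [sq_nonneg (a * g - d * e)]
  have := abs_le_of_sq_le_sq' hcs (by positivity)
  nlinarith [this.2]

/-- The trace pairs the partial trace of `M` over the output with the reduced state of `ρ`, which
has trace one. -/
theorem trace_ofChoi_le {M : BiMat 2} (hM : M.PosSemidef) {m : ℕ} {ρ : BiMat m}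
    (hρ : IsDensity ρ) : (ofChoi M ρ).trace.re ≤ M.trace.re := by
  have hA : (∑ i : Fin 2, M.submatrix (fun k => (i, k)) (fun k => (i, k))).PosSemidef :=
    Matrix.posSemidef_sum _ fun i _ => hM.submatrix _
  have hB : (∑ a : Fin m, ρ.submatrix (fun k => (k, a)) (fun k => (k, a))).PosSemidef :=
    Matrix.posSemidef_sum _ fun i _ => hρ.1.submatrix _
  have h := re_sum_mul_le hA hB
  have h1 : (∑ i : Fin 2, M.submatrix (fun k => (i, k)) (fun k => (i, k))).trace = M.trace := by
    simp only [Matrix.trace, Matrix.diag, Matrix.sum_apply, Matrix.submatrix_apply,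
      Fintype.sum_prod_type]
    exact Finset.sum_comm
  have h2 : (∑ a : Fin m, ρ.submatrix (fun k => (k, a)) (fun k => (k, a))).trace = 1 := by
    rw [← hρ.2]
    simp only [Matrix.trace, Matrix.diag, Matrix.sum_apply, Matrix.submatrix_apply,
      Fintype.sum_prod_type]
  rw [h1, h2, Complex.one_re, mul_one] at h
  convert h using 2
  simp only [Matrix.trace, Matrix.diag, Matrix.sum_apply, Matrix.submatrix_apply,
    Fintype.sum_prod_type, ofChoi, Matrix.of_apply, Fin.sum_univ_two, Finset.sum_add_distrib,
    ← Finset.mul_sum]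
  ring

theorem DiffBound.ofChoi {M : BiMat 2} {x : ℝ} (h : DiffBound M x) {m : ℕ} {ρ : BiMat m}
    (hρ : IsDensity ρ) : DiffBound (ofChoi M ρ) x := by
  obtain ⟨P, N, hP, hN, rfl, hx⟩ := h
  refine ⟨_, _, posSemidef_ofChoi hP hρ.1, posSemidef_ofChoi hN hρ.1, ofChoi_sub _ _ _, ?_⟩
  rw [Complex.add_re] at hx ⊢
  linarith [trace_ofChoi_le hP hρ, trace_ofChoi_le hN hρ]

/-! ### Entanglement fidelity and distance to the identity -/

/-- Four times the entanglement fidelity of a map, which is `1` for the identity. -/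
def entFidelity (Φ : QMap) : ℂ := bell ⬝ᵥ (choi Φ).mulVec bell

/-- The projector onto the maximally entangled state. -/
def bellProj : BiMat 2 := (1 / 2 : ℂ) • Matrix.vecMulVec bell bell

theorem bellProj_isHermitian : bellProj.conjTranspose = bellProj := by
  rw [bellProj, Matrix.conjTranspose_smul, Matrix.conjTranspose_vecMulVec, star_bell]
  simp

theorem bell_dotProduct_bell : bell ⬝ᵥ bell = 2 := by
  simp [dotProduct, bell, Fintype.sum_prod_type]

theorem bellProj_mul_self : bellProj * bellProj = bellProj := by
  rw [bellProj, Matrix.smul_mul, Matrix.mul_smul, Matrix.vecMulVec_mul_vecMulVec,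
    bell_dotProduct_bell, Matrix.vecMulVec_smul]
  simp [smul_smul]

theorem posSemidef_bellProj : bellProj.PosSemidef := by
  have h := Matrix.posSemidef_vecMulVec_self_star bell
  rw [star_bell] at h
  exact h.smul (by simp)

theorem bellProj_mul_mul (Φ : QMap) :
    bellProj * choi Φ * bellProj = (entFidelity Φ / 2) • bellProj := by
  rw [bellProj, Matrix.smul_mul, Matrix.smul_mul, Matrix.mul_smul, Matrix.vecMulVec_mul,
    Matrix.vecMulVec_mul_vecMulVec, ← Matrix.dotProduct_mulVec, ← entFidelity,
    Matrix.vecMulVec_smul, smul_smul, smul_smul, smul_smul]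
  congr 1
  ring

theorem trace_bellProj : bellProj.trace = 1 := by
  simp [bellProj, Matrix.trace_vecMulVec, bell_dotProduct_bell]


theorem trace_bellProj_mul_choi (Φ : QMap) : (bellProj * choi Φ).trace = entFidelity Φ / 2 := by
  rw [← bellProj_mul_self, Matrix.mul_assoc, Matrix.trace_mul_comm, bellProj_mul_mul,
    Matrix.trace_smul, trace_bellProj, smul_eq_mul, mul_one]

theorem trace_bellProj_compl (Φ : QChannel) :
    ((1 - bellProj) * choi Φ.toMap * (1 - bellProj)).trace = 2 - entFidelity Φ.toMap / 2 := by
  have h : (1 - bellProj) * (1 - bellProj) = 1 - bellProj := by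
    rw [Matrix.mul_sub, Matrix.mul_one, Matrix.sub_mul, Matrix.one_mul, bellProj_mul_self, sub_self,
      sub_zero]
  rw [Matrix.trace_mul_comm, ← Matrix.mul_assoc, h, Matrix.sub_mul, Matrix.one_mul,
    Matrix.trace_sub, Φ.trace_choi, trace_bellProj_mul_choi]

theorem bellProj_compl_isHermitian : (1 - bellProj).conjTranspose = 1 - bellProj := by
  rw [Matrix.conjTranspose_sub, bellProj_isHermitian, Matrix.conjTranspose_one]

theorem QChannel.posSemidef_compl (Φ : QChannel) :
    ((1 - bellProj) * choi Φ.toMap * (1 - bellProj)).PosSemidef := by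
  have h := Φ.posSemidef_choi.conjTranspose_mul_mul_same (1 - bellProj)
  rwa [bellProj_compl_isHermitian] at h

theorem QChannel.entFidelity_nonneg (Φ : QChannel) : 0 ≤ entFidelity Φ.toMap := by
  have h := Φ.posSemidef_choi.dotProduct_mulVec_nonneg bell
  rwa [star_bell] at h

theorem QChannel.entFidelity_re_le (Φ : QChannel) : (entFidelity Φ.toMap).re ≤ 4 := by
  have h := (Complex.le_def.1 Φ.posSemidef_compl.trace_nonneg).1
  rw [trace_bellProj_compl] at h
  simp at h
  linarith

/-- Split the Choi matrix `J` into blocks along the Bell projector `Q` and its complement `R`. The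
corner `R J R` is small because the fidelity is high, and the off-diagonal blocks are then small by
positivity of `J`. -/
theorem QChannel.diffBound_choi (Φ : QChannel) {η : ℝ} (h0 : 0 < η) (h1 : η ≤ 1)
    (h : 4 - 4 * η ^ 2 ≤ (entFidelity Φ.toMap).re) :
    DiffBound (choi Φ.toMap - Matrix.vecMulVec bell bell) (8 * η) := by
  set J := choi Φ.toMap with hJ
  set Q := bellProj with hQ
  set R := 1 - bellProj with hR
  set f := entFidelity Φ.toMap with hf
  have hJpos : J.PosSemidef := Φ.posSemidef_choi
  have hQJQ : Q * J * Q = (f / 2) • Q := bellProj_mul_mul _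
  have hRJR : (R * J * R).PosSemidef := Φ.posSemidef_compl
  have trR : (R * J * R).trace = 2 - f / 2 := trace_bellProj_compl Φ
  have trQ : (Q * J * Q).trace = f / 2 := by
    rw [hQJQ, Matrix.trace_smul, trace_bellProj, smul_eq_mul, mul_one]
  have hQQ : Q * Q = Q := bellProj_mul_self
  have trQ1 : Q.trace = 1 := trace_bellProj
  have trQR : (Q * J * R).trace = 0 := by
    rw [Matrix.trace_mul_comm, ← Matrix.mul_assoc, hR, Matrix.sub_mul, Matrix.one_mul, hQQ,
      sub_self, Matrix.zero_mul, Matrix.trace_zero]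
  have trRQ : (R * J * Q).trace = 0 := by
    rw [Matrix.trace_mul_comm, ← Matrix.mul_assoc, hR, Matrix.mul_sub, Matrix.mul_one, hQQ,
      sub_self, Matrix.zero_mul, Matrix.trace_zero]
  have hsandwich (s : ℂ) (hs : star s = s) :
      ((s • Q + R) * J * (s • Q + R)).PosSemidef := by
    have h := hJpos.conjTranspose_mul_mul_same (s • Q + R)
    rwa [Matrix.conjTranspose_add, Matrix.conjTranspose_smul, bellProj_isHermitian,
      bellProj_compl_isHermitian, hs] at h
  have hexpand (s : ℂ) : (s • Q + R) * J * (s • Q + R) =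
      s ^ 2 • (Q * J * Q) + s • (Q * J * R) + s • (R * J * Q) + R * J * R := by
    simp only [Matrix.add_mul, Matrix.mul_add, Matrix.smul_mul, Matrix.mul_smul, smul_add,
      smul_smul, sq]
    abel
  have hη : (η : ℂ) ≠ 0 := by exact_mod_cast h0.ne'
  have hc : (0 : ℂ) ≤ ((1 / (2 * η) : ℝ) : ℂ) := by exact_mod_cast (by positivity)
  have him : f.im = 0 := (Complex.le_def.1 Φ.entFidelity_nonneg).2.symm
  have hf4 : f.re ≤ 4 := Φ.entFidelity_re_le
  have hfd : (0 : ℂ) ≤ 2 - f / 2 := by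
    rw [← trR]
    exact hRJR.trace_nonneg
  -- Polarization writes `Q J R + R J Q` as the difference of the two sandwiches by `±η Q + R`,
  -- divided by `2η`. The weight `η` balances the large corner `Q J Q` against the corner `R J R`,
  -- whose trace is at most `2η²`. The remaining block is `Q J Q - 2 Q = -(2 - f / 2) Q`.
  refine ⟨R * J * R + ((1 / (2 * η) : ℝ) : ℂ) • (((η : ℂ) • Q + R) * J * ((η : ℂ) • Q + R)),
    (2 - f / 2) • Q + ((1 / (2 * η) : ℝ) : ℂ) • (((-η : ℂ) • Q + R) * J * ((-η : ℂ) • Q + R)),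
    hRJR.add ((hsandwich _ (by simp)).smul hc),
    (posSemidef_bellProj.smul hfd).add ((hsandwich _ (by simp)).smul hc), ?_, ?_⟩
  · have hdecomp : J = Q * J * Q + Q * J * R + R * J * Q + R * J * R := by
      rw [← Matrix.mul_add, add_assoc, ← Matrix.mul_add, ← Matrix.add_mul, ← Matrix.add_mul]
      simp [hR, hQ]
    have hω : Matrix.vecMulVec bell bell = (2 : ℂ) • Q := by
      rw [hQ, bellProj, smul_smul]
      norm_num
    rw [hω]
    conv_lhs => rw [hdecomp]
    rw [hexpand, hexpand, hQJQ]
    push_cast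
    match_scalars <;> field_simp <;> ring
  · rw [hexpand, hexpand]
    simp only [Matrix.trace_add, Matrix.trace_smul, trR, trQ, trQR, trRQ, trQ1,
      smul_eq_mul]
    have : (2 - f / 2 + ((1 / (2 * η) : ℝ) : ℂ) * ((η : ℂ) ^ 2 * (f / 2) + η * 0 + η * 0 +
        (2 - f / 2)) + ((2 - f / 2) * 1 + ((1 / (2 * η) : ℝ) : ℂ) * ((-η : ℂ) ^ 2 * (f / 2) +
        -η * 0 + -η * 0 + (2 - f / 2)))) =
        ((4 - f.re + η * (f.re / 2) + (2 - f.re / 2) / η : ℝ) : ℂ) := by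
      have : f = (f.re : ℂ) := Complex.ext rfl (by simpa using him)
      rw [this]
      push_cast
      rw [Complex.ofReal_re]
      field_simp
      ring
    rw [this, Complex.ofReal_re]
    -- The three contributions are at most `4η²`, `2η` and `2η`, and `η² ≤ η`.
    have h2 : (2 - f.re / 2) / η ≤ 2 * η := by
      rw [div_le_iff₀ h0]
      nlinarith
    nlinarith

theorem QChannel.diffBound_ampl_sub (Φ : QChannel) {η : ℝ} (h0 : 0 < η) (h1 : η ≤ 1)
    (h : 4 - 4 * η ^ 2 ≤ (entFidelity Φ.toMap).re) {m : ℕ} {ρ : BiMat m} (hρ : IsDensity ρ) :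
    DiffBound (ampl Φ.toMap m ρ - ρ) (8 * η) := by
  have := (Φ.diffBound_choi h0 h1 h).ofChoi hρ
  rwa [ofChoi_sub, ofChoi_bell, ← ampl_eq_ofChoi] at this

/-! ### Pauli matrices -/

theorem trace_pauli (a : Fin 3) : (pauli a).trace = 0 := by
  fin_cases a <;> simp [pauli, Matrix.trace, Fin.sum_univ_two]

theorem pauli_mul_self (a : Fin 3) : pauli a * pauli a = 1 := by
  fin_cases a <;> ext i j <;> fin_cases i <;> fin_cases j <;>
    simp [pauli, Matrix.mul_apply, Fin.sum_univ_two]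

theorem pauli_conjTranspose (a : Fin 3) : (pauli a).conjTranspose = pauli a := by
  fin_cases a <;> ext i j <;> fin_cases i <;> fin_cases j <;>
    simp [pauli, Matrix.conjTranspose_apply]

theorem trace_pauli_mul (a b : Fin 3) : (pauli a * pauli b).trace = if a = b then 2 else 0 := by
  fin_cases a <;> fin_cases b <;>
    simp [pauli, Matrix.trace, Fin.sum_univ_two] <;> norm_num

theorem pauli_expansion (A : QMat) :
    A = (A.trace / 2) • (1 : QMat) + ∑ b, ((A * pauli b).trace / 2) • pauli b := by
  ext i j
  fin_cases i <;> fin_cases j <;>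
    simp [pauli, Matrix.trace, Matrix.mul_apply, Fin.sum_univ_two, Fin.sum_univ_three] <;>
    ring_nf <;> simp <;> ring

theorem gate_apply (U A : QMat) : gate U A = U * A * U.conjTranspose := rfl

theorem gate_mul (U V : QMat) : gate (U * V) = gate U ∘ₗ gate V := by
  ext1 A
  simp only [gate_apply, LinearMap.comp_apply, Matrix.conjTranspose_mul, Matrix.mul_assoc]

theorem gate_pauli (a b : Fin 3) :
    gate (pauli b) (pauli a) = (if a = b then (1 : ℂ) else -1) • pauli a := by
  rw [gate_apply, pauli_conjTranspose]
  fin_cases a <;> fin_cases b <;> ext i j <;> fin_cases i <;> fin_cases j <;>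
    simp [pauli, Matrix.mul_apply, Fin.sum_univ_two]

theorem pauli_mem_unitaryGroup (a : Fin 3) : pauli a ∈ Matrix.unitaryGroup (Fin 2) ℂ := by
  rw [Matrix.mem_unitaryGroup_iff, Matrix.star_eq_conjTranspose, pauli_conjTranspose,
    pauli_mul_self]

theorem mem_pauliGroup_iff (A : QMat) : A ∈ pauliGroup ↔
    ∃ n : ℕ, A = Complex.I ^ n • (1 : QMat) ∨ ∃ a, A = Complex.I ^ n • pauli a := by
  refine ⟨fun ⟨r, h⟩ => ⟨r, h⟩, fun ⟨n, h⟩ => ⟨⟨n % 4, Nat.mod_lt _ (by norm_num)⟩, ?_⟩⟩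
  rwa [Complex.I_pow_eq_pow_mod] at h

theorem finite_pauliGroup : pauliGroup.Finite := by
  refine (Set.finite_range fun x : Fin 4 × Option (Fin 3) =>
    Complex.I ^ (x.1 : ℕ) • x.2.elim (1 : QMat) pauli).subset ?_
  rintro A ⟨r, rfl | ⟨a, rfl⟩⟩
  · exact ⟨(r, none), rfl⟩
  · exact ⟨(r, some a), rfl⟩

/-! ### The Clifford group -/

theorem conj_mem_pauliGroup {U : QMat} (hU : U ∈ Matrix.unitaryGroup (Fin 2) ℂ)
    (h : ∀ a, ∃ (n : ℕ) (b : Fin 3), gate U (pauli a) = Complex.I ^ n • pauli b) {A : QMat}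
    (hA : A ∈ pauliGroup) : U * A * U.conjTranspose ∈ pauliGroup := by
  rw [mem_pauliGroup_iff] at hA ⊢
  rw [Matrix.mem_unitaryGroup_iff, Matrix.star_eq_conjTranspose] at hU
  obtain ⟨n, rfl | ⟨a, rfl⟩⟩ := hA
  · exact ⟨n, Or.inl (by rw [Matrix.mul_smul, Matrix.mul_one, Matrix.smul_mul, hU])⟩
  · obtain ⟨m, b, hb⟩ := h a
    rw [gate_apply] at hb
    exact ⟨n + m, Or.inr ⟨b, by rw [Matrix.mul_smul, Matrix.smul_mul, hb, smul_smul, pow_add]⟩⟩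

/-- Normalizing is an equivalence, so its converse needs the same check for the inverse `U†`; for
both it suffices to look at `X`, `Y`, `Z`. -/
theorem exists_cliff {U : QMat} (hU : U ∈ Matrix.unitaryGroup (Fin 2) ℂ)
    (h : ∀ a, ∃ (n : ℕ) (b : Fin 3), gate U (pauli a) = Complex.I ^ n • pauli b)
    (h' : ∀ a, ∃ (n : ℕ) (b : Fin 3), gate U.conjTranspose (pauli a) = Complex.I ^ n • pauli b) :
    ∃ C : Cliff, C.val = gate U := by
  refine ⟨⟨gate U, U, hU, fun A => ⟨conj_mem_pauliGroup hU h, fun hA => ?_⟩, rfl⟩, rfl⟩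
  have hU' := hU
  rw [Matrix.mem_unitaryGroup_iff', Matrix.star_eq_conjTranspose] at hU'
  have := conj_mem_pauliGroup (Unitary.star_mem hU) h' hA
  rw [Matrix.star_eq_conjTranspose, Matrix.conjTranspose_conjTranspose, Matrix.mul_assoc,
    Matrix.mul_assoc, hU', Matrix.mul_one, ← Matrix.mul_assoc, hU', Matrix.one_mul] at this
  exact this

theorem exists_cliff_pauli (b : Fin 3) : ∃ C : Cliff, C.val = gate (pauli b) := by
  have h (a : Fin 3) : ∃ (n : ℕ) (c : Fin 3), gate (pauli b) (pauli a) = Complex.I ^ n • pauli c := by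
    rw [gate_pauli]
    split_ifs
    · exact ⟨0, a, by simp⟩
    · exact ⟨2, a, by simp⟩
  exact exists_cliff (pauli_mem_unitaryGroup b) h (by rwa [pauli_conjTranspose])

/-- The unitary that permutes the Pauli matrices cyclically. -/
def cyclicUnitary : QMat :=
  (1 / 2 : ℂ) • !![1 - Complex.I, -1 - Complex.I; 1 - Complex.I, 1 + Complex.I]

theorem cyclicUnitary_conjTranspose : cyclicUnitary.conjTranspose =
    (1 / 2 : ℂ) • !![1 + Complex.I, 1 + Complex.I; -1 + Complex.I, 1 - Complex.I] := by
  rw [cyclicUnitary]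
  ext i j
  fin_cases i <;> fin_cases j <;> simp [Matrix.conjTranspose_apply, sub_eq_add_neg]

theorem gate_cyclicUnitary (a : Fin 3) : gate cyclicUnitary (pauli a) = pauli (a + 1) := by
  rw [gate_apply, cyclicUnitary_conjTranspose, cyclicUnitary]
  fin_cases a <;> ext i j <;> fin_cases i <;> fin_cases j <;>
    simp [pauli, Matrix.mul_apply, Fin.sum_univ_two] <;> ring_nf <;> norm_num [Complex.I_sq]

theorem gate_cyclicUnitary_conjTranspose (a : Fin 3) :
    gate cyclicUnitary.conjTranspose (pauli a) = pauli (a + 2) := by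
  rw [gate_apply, Matrix.conjTranspose_conjTranspose, cyclicUnitary_conjTranspose, cyclicUnitary]
  fin_cases a <;> ext i j <;> fin_cases i <;> fin_cases j <;>
    simp [pauli, Matrix.mul_apply, Fin.sum_univ_two] <;> ring_nf <;>
      (norm_num [Complex.I_sq]; try ring_nf)

theorem cyclicUnitary_mem : cyclicUnitary ∈ Matrix.unitaryGroup (Fin 2) ℂ := by
  rw [Matrix.mem_unitaryGroup_iff, Matrix.star_eq_conjTranspose,
    cyclicUnitary_conjTranspose, cyclicUnitary]
  ext i j
  fin_cases i <;> fin_cases j <;>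
    simp [Matrix.mul_apply, Fin.sum_univ_two] <;> ring_nf <;> norm_num [Complex.I_sq]

theorem exists_cliff_cyclic : ∃ C : Cliff, ∀ a, C.val (pauli a) = pauli (a + 1) := by
  obtain ⟨C, hC⟩ := exists_cliff cyclicUnitary_mem
    (fun a => ⟨0, a + 1, by rw [gate_cyclicUnitary]; simp⟩)
    (fun a => ⟨0, a + 2, by rw [gate_cyclicUnitary_conjTranspose]; simp⟩)
  exact ⟨C, fun a => by rw [hC, gate_cyclicUnitary]⟩

/-- Composition of Clifford gates. -/
def Cliff.comp (C C' : Cliff) : Cliff :=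
  ⟨C.val ∘ₗ C'.val, by
    obtain ⟨U, hU, hUP, hC⟩ := C.2
    obtain ⟨V, hV, hVP, hC'⟩ := C'.2
    refine ⟨U * V, mul_mem hU hV, fun A => ?_, by rw [gate_mul, hC, hC']⟩
    rw [hVP, hUP]
    simp only [Matrix.conjTranspose_mul, Matrix.mul_assoc]⟩

theorem Cliff.map_one (C : Cliff) : C.val 1 = 1 := by
  obtain ⟨U, hU, -, hC⟩ := C.2
  rw [hC, gate_apply, Matrix.mul_one]
  exact Matrix.mem_unitaryGroup_iff.1 hU

theorem Cliff.map_mul (C : Cliff) (A B : QMat) : C.val A * C.val B = C.val (A * B) := by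
  obtain ⟨U, hU, -, hC⟩ := C.2
  rw [Matrix.mem_unitaryGroup_iff', Matrix.star_eq_conjTranspose] at hU
  simp only [hC, gate_apply]
  calc _ = U * A * (U.conjTranspose * U) * B * U.conjTranspose := by simp only [Matrix.mul_assoc]
    _ = _ := by rw [hU]; simp only [Matrix.mul_assoc, Matrix.one_mul]

theorem Cliff.trace_map (C : Cliff) (A : QMat) : (C.val A).trace = A.trace := by
  obtain ⟨U, hU, -, hC⟩ := C.2
  rw [hC]
  exact (gateChannel ⟨U, hU⟩).tracePreserving A

theorem Cliff.surjective (C : Cliff) : Function.Surjective C.val := by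
  obtain ⟨U, hU, -, hC⟩ := C.2
  intro A
  rw [Matrix.mem_unitaryGroup_iff, Matrix.star_eq_conjTranspose] at hU
  refine ⟨U.conjTranspose * A * U, ?_⟩
  rw [hC, gate_apply]
  calc _ = (U * U.conjTranspose) * A * (U * U.conjTranspose) := by simp only [Matrix.mul_assoc]
    _ = _ := by rw [hU, Matrix.one_mul, Matrix.mul_one]

theorem pauli_mem_pauliGroup (a : Fin 3) : pauli a ∈ pauliGroup :=
  (mem_pauliGroup_iff _).2 ⟨0, Or.inr ⟨a, by simp⟩⟩

theorem Cliff.map_pauli_mem (C : Cliff) (a : Fin 3) : C.val (pauli a) ∈ pauliGroup := by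
  obtain ⟨U, hU, hUP, hC⟩ := C.2
  rw [hC]
  exact (hUP _).1 (pauli_mem_pauliGroup a)

instance : Finite Cliff := by
  have := finite_pauliGroup.to_subtype
  refine Finite.of_injective
    -- A Clifford gate fixes `1`, so it is determined by its values on the three Pauli matrices,
    -- which lie in a finite set.
    (fun (C : Cliff) (a : Fin 3) => (⟨C.val (pauli a), C.map_pauli_mem a⟩ : pauliGroup))
    fun C C' h => Subtype.ext (LinearMap.ext fun A => ?_)
  have h' (a : Fin 3) : C.val (pauli a) = C'.val (pauli a) :=
    congrArg Subtype.val (congrFun h a)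
  rw [pauli_expansion A]
  simp only [map_add, map_smul, map_sum, C.map_one, C'.map_one, h']

instance : Fintype Cliff := Fintype.ofFinite _

/-- Clifford gates act as signed permutations: preservation of the trace excludes multiples of `1`,
the relation `P² = 1` forces signs, and orthogonality of distinct Pauli matrices forces injectivity.
-/
theorem Cliff.map_pauli (C : Cliff) : ∃ (π : Fin 3 → Fin 3) (s : Fin 3 → ℂ),
    Function.Injective π ∧ ∀ a, s a ^ 2 = 1 ∧ C.val (pauli a) = s a • pauli (π a) := by
  have h (a : Fin 3) : ∃ (b : Fin 3) (s : ℂ), s ^ 2 = 1 ∧ C.val (pauli a) = s • pauli b := by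
    obtain ⟨n, h | ⟨b, h⟩⟩ := (mem_pauliGroup_iff _).1 (C.map_pauli_mem a)
    · have := C.trace_map (pauli a)
      rw [h, trace_pauli, Matrix.trace_smul] at this
      simp at this
    · refine ⟨b, _, ?_, h⟩
      have := C.map_mul (pauli a) (pauli a)
      rw [h, pauli_mul_self, C.map_one, Matrix.smul_mul, Matrix.mul_smul, pauli_mul_self,
        smul_smul] at this
      have := congrFun (congrFun this 0) 0
      simpa [sq] using this
  choose π s hs using h
  refine ⟨π, s, fun a b hab => ?_, hs⟩
  by_contra hne
  have h1 := C.trace_map (pauli a * pauli b)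
  rw [← C.map_mul, (hs a).2, (hs b).2, Matrix.smul_mul, Matrix.mul_smul, smul_smul,
    Matrix.trace_smul, trace_pauli_mul, trace_pauli_mul, if_pos hab, if_neg hne] at h1
  have ha : s a ≠ 0 := fun h => by simpa [h] using (hs a).1
  have hb : s b ≠ 0 := fun h => by simpa [h] using (hs b).1
  simp [ha, hb] at h1

/-- The identity and the three Pauli conjugations differ, since conjugation by one Pauli matrix
negates the other two. -/
theorem four_le_card_cliff : 4 ≤ Nat.card Cliff := by
  choose P hP using exists_cliff_pauli
  have hone : ∃ C : Cliff, C.val = gate 1 := ⟨((P 0).comp (P 0)), by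
    rw [Cliff.comp]
    simp only [hP, ← gate_mul, pauli_mul_self]⟩
  obtain ⟨E, hE⟩ := hone
  have hne (a : Fin 3) : pauli a ≠ (-1 : ℂ) • pauli a := fun h => by
    have := congrArg (fun A => (A * pauli a).trace) h
    simp only [Matrix.smul_mul, Matrix.trace_smul, pauli_mul_self, Matrix.trace_one] at this
    norm_num at this
  have hinj : Function.Injective fun x : Option (Fin 3) => x.elim E P := by
    have key (a b : Fin 3) (hab : a ≠ b) : gate (pauli b) (pauli a) ≠ pauli a := fun h => by
      rw [gate_pauli, if_neg hab] at h
      exact hne a h.symm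
    have hEP (b : Fin 3) : E ≠ P b := fun h => by
      have h1 : gate (pauli b) (pauli (b + 1)) = gate 1 (pauli (b + 1)) := by rw [← hP, ← hE, h]
      refine key (b + 1) b (by simp) ?_
      rw [h1, gate_apply]
      simp
    rintro (_ | a) (_ | b) h
    · rfl
    · exact absurd h (hEP b)
    · exact absurd h.symm (hEP a)
    · by_contra hab
      have hab' : a ≠ b := fun h => hab (congrArg some h)
      have h1 : gate (pauli a) = gate (pauli b) := by
        rw [← hP, ← hP]
        exact congrArg Subtype.val h
      refine key a b hab' ?_
      rw [← h1, gate_pauli, if_pos rfl, one_smul]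
  have := Nat.card_le_card_of_injective _ hinj
  simpa using this

/-! ### The Clifford twirl -/

theorem Cliff.bijective_comp (C : Cliff) : Function.Bijective fun C' : Cliff => C'.comp C := by
  refine Finite.injective_iff_bijective.1 fun C₁ C₂ h => Subtype.ext (LinearMap.ext fun A => ?_)
  obtain ⟨A, rfl⟩ := C.surjective A
  exact LinearMap.congr_fun (congrArg Subtype.val h) A

/-- The Clifford twirl of a bilinear form. -/
def twirl (B : QMat →ₗ[ℂ] QMat →ₗ[ℂ] ℂ) : QMat →ₗ[ℂ] QMat →ₗ[ℂ] ℂ :=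
  ∑ C : Cliff, B.compl₁₂ C.val C.val

theorem twirl_apply (B : QMat →ₗ[ℂ] QMat →ₗ[ℂ] ℂ) (X Y : QMat) :
    twirl B X Y = ∑ C : Cliff, B (C.val X) (C.val Y) := by
  simp [twirl]

theorem twirl_map (B : QMat →ₗ[ℂ] QMat →ₗ[ℂ] ℂ) (C : Cliff) (X Y : QMat) :
    twirl B (C.val X) (C.val Y) = twirl B X Y := by
  rw [twirl_apply, twirl_apply]
  exact Fintype.sum_bijective _ C.bijective_comp _ _ fun _ => rfl

/-- Conjugation by `pauli b` fixes `pauli b` and negates `pauli a`, so invariance makes the value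
equal to its negative. -/
theorem twirl_pauli_of_ne (B : QMat →ₗ[ℂ] QMat →ₗ[ℂ] ℂ) {a b : Fin 3} (hab : a ≠ b) :
    twirl B (pauli a) (pauli b) = 0 := by
  obtain ⟨C, hC⟩ := exists_cliff_pauli b
  have h := twirl_map B C (pauli a) (pauli b)
  rw [hC, gate_pauli, gate_pauli, if_neg hab, if_pos rfl, one_smul, map_smul,
    LinearMap.smul_apply, smul_eq_mul] at h
  linear_combination (-1 / 2 : ℂ) * h

/-- The cyclic gate makes the three diagonal values equal. Their sum is known because each Clifford
gate only permutes the Pauli matrices up to signs, which square to one. -/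
theorem twirl_pauli_self (B : QMat →ₗ[ℂ] QMat →ₗ[ℂ] ℂ) (a : Fin 3) :
    twirl B (pauli a) (pauli a) = Nat.card Cliff / 3 * ∑ b, B (pauli b) (pauli b) := by
  obtain ⟨Z, hZ⟩ := exists_cliff_cyclic
  have hcyc (a : Fin 3) :
      twirl B (pauli (a + 1)) (pauli (a + 1)) = twirl B (pauli a) (pauli a) := by
    rw [← hZ, twirl_map]
  have hsum : ∑ a, twirl B (pauli a) (pauli a) = Nat.card Cliff * ∑ b, B (pauli b) (pauli b) := by
    simp only [twirl_apply]
    rw [Finset.sum_comm, Finset.sum_congr rfl (g := fun _ => ∑ b, B (pauli b) (pauli b))]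
    · simp
    · intro C _
      obtain ⟨π, s, hπ, h⟩ := C.map_pauli
      refine Fintype.sum_bijective π (Finite.injective_iff_bijective.1 hπ) _ _ fun a => ?_
      rw [(h a).2, map_smul, map_smul, LinearMap.smul_apply, smul_smul, ← sq, (h a).1, one_smul]
  have h0 := hcyc 0
  have h1 := hcyc 1
  rw [Fin.sum_univ_three] at hsum
  norm_num at h0 h1
  have h2 : twirl B (pauli 2) (pauli 2) = twirl B (pauli 1) (pauli 1) := h1
  have h3 : twirl B (pauli a) (pauli a) = twirl B (pauli 0) (pauli 0) := by
    fin_cases a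
    exacts [rfl, h0, h2.trans h0]
  linear_combination (1 / 3 : ℂ) * hsum - (2 / 3 : ℂ) * h0 - (1 / 3 : ℂ) * h2 + h3

/-- The mean overlap of the images of the Pauli matrices under two maps. -/
def pauliCorr (Φ Ψ : QMap) : ℂ := 1 / 6 * ∑ a, (Φ (pauli a) * Ψ (pauli a)).trace

theorem pauliCorr_id : pauliCorr LinearMap.id LinearMap.id = 1 := by
  simp [pauliCorr, trace_pauli_mul]
  norm_num

/-- Averaging over the gate right after `Λ` splits off its noise as a scalar: `Λ (pauli a)` is
traceless, and the twirl keeps only its component along `pauli a`. -/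
theorem sum_pauliCorr_comp (Φ Ψ : QMap) (Λ : QChannel) :
    ∑ C : Cliff, pauliCorr (Φ ∘ₗ C.val ∘ₗ Λ.toMap) (Ψ ∘ₗ C.val) =
      Nat.card Cliff * pauliCorr Λ.toMap LinearMap.id * pauliCorr Φ Ψ := by
  let B : QMat →ₗ[ℂ] QMat →ₗ[ℂ] ℂ := LinearMap.mk₂ ℂ (fun X Y => (Φ X * Ψ Y).trace)
    (by simp [Matrix.add_mul]) (by simp) (by simp [Matrix.mul_add]) (by simp)
  have h1 (a : Fin 3) : twirl B (Λ.toMap (pauli a)) (pauli a) =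
      (Λ.toMap (pauli a) * pauli a).trace / 2 *
        (Nat.card Cliff / 3 * ∑ b, B (pauli b) (pauli b)) := by
    rw [pauli_expansion (Λ.toMap (pauli a)), Λ.tracePreserving, trace_pauli, zero_div, zero_smul,
      zero_add, map_sum, LinearMap.sum_apply, Finset.sum_eq_single a]
    · rw [map_smul, LinearMap.smul_apply, twirl_pauli_self, smul_eq_mul]
      congr 1
      have := pauli_expansion (Λ.toMap (pauli a))
      rw [Λ.tracePreserving, trace_pauli, zero_div, zero_smul, zero_add] at this
      rw [← this]
    · intro b _ hb
      rw [map_smul, LinearMap.smul_apply, twirl_pauli_of_ne B hb, smul_zero]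
    · simp
  calc _ = 1 / 6 * ∑ a, twirl B (Λ.toMap (pauli a)) (pauli a) := by
        simp only [pauliCorr, twirl_apply, ← Finset.mul_sum]
        rw [Finset.sum_comm]
        rfl
    _ = _ := by
        simp only [h1, ← Finset.sum_mul, ← Finset.sum_div, pauliCorr, LinearMap.id_apply]
        have : ∑ b, B (pauli b) (pauli b) = ∑ b, (Φ (pauli b) * Ψ (pauli b)).trace := rfl
        rw [this]
        ring

/-- The devices from the second round on. -/
def Devices.shift (D : Devices) : Devices where
  send j := D.send (j + 1)
  mem j := D.mem (j + 1)
  gateNoise j := D.gateNoise (j + 1)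

/-- Peeling off the first round, rather than the last, exposes the first noise acting directly on a
Pauli matrix, as the twirl requires. -/
theorem rounds_succ' (D : Devices) (k : ℕ) (G : Fin (k + 1) → QMap) :
    rounds D (k + 1) G = rounds D.shift k (fun j => G j.succ) ∘ₗ G 0 ∘ₗ (D.noise 0).toMap := by
  induction k with
  | zero => rfl
  | succ k ih =>
    rw [rounds_succ, ih, rounds_succ]
    rfl

theorem sum_pauliCorr_rounds (D : Devices) (k : ℕ) :
    ∑ c : Fin k → Cliff, pauliCorr (rounds D k fun j => (c j).val)
        (rounds Devices.ideal k fun j => (c j).val) =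
      (Nat.card Cliff : ℂ) ^ k *
        ∏ j ∈ Finset.range k, pauliCorr (D.noise j).toMap LinearMap.id := by
  induction k generalizing D with
  | zero => simp [rounds, pauliCorr_id]
  | succ k ih =>
    rw [← (Fin.consEquiv fun _ => Cliff).sum_comp, Fintype.sum_prod_type_right]
    have h (c : Fin k → Cliff) := sum_pauliCorr_comp (rounds D.shift k fun j => (c j).val)
      (rounds Devices.ideal k fun j => (c j).val) (D.noise 0)
    have h' (c : Fin k → Cliff) (C : Cliff) :
        pauliCorr (rounds D (k + 1) fun j => ((Fin.consEquiv fun _ => Cliff) (C, c) j).val)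
          (rounds Devices.ideal (k + 1) fun j => ((Fin.consEquiv fun _ => Cliff) (C, c) j).val) =
        pauliCorr (rounds D.shift k (fun j => (c j).val) ∘ₗ C.val ∘ₗ (D.noise 0).toMap)
          (rounds Devices.ideal k (fun j => (c j).val) ∘ₗ C.val) := by
      rw [rounds_succ', rounds_succ']
      rfl
    simp only [h', h, ← Finset.mul_sum, ih, Finset.prod_range_succ']
    rw [pow_succ]
    have : ∀ j, (D.shift.noise j).toMap = (D.noise (j + 1)).toMap := fun _ => rfl
    simp only [this]
    ring

/-- Expanding the Bell projector in Pauli matrices gives `f = (Tr Φ(1) + ∑ Tr (Φ(P) P)) / 2`, and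
`Tr Φ(1) = 2`. -/
theorem QChannel.entFidelity_eq (Φ : QChannel) :
    entFidelity Φ.toMap = 1 + 3 * pauliCorr Φ.toMap LinearMap.id := by
  have e0 : pauli 0 = Matrix.single 0 1 1 + Matrix.single 1 0 1 := by
    ext i j; fin_cases i <;> fin_cases j <;> simp [pauli]
  have e1 : pauli 1 = (-Complex.I) • Matrix.single 0 1 1 + Complex.I • Matrix.single 1 0 1 := by
    ext i j; fin_cases i <;> fin_cases j <;> simp [pauli]
  have e2 : pauli 2 = Matrix.single 0 0 1 - Matrix.single 1 1 1 := by
    ext i j; fin_cases i <;> fin_cases j <;> simp [pauli]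
  have t0 := Φ.tracePreserving (Matrix.single 0 0 1)
  have t1 := Φ.tracePreserving (Matrix.single 1 1 1)
  have hf : entFidelity Φ.toMap = ∑ i, ∑ j, Φ.toMap (Matrix.single i j 1) i j := by
    simp [entFidelity, dotProduct, Matrix.mulVec, Fintype.sum_prod_type, bell, choi_apply]
  have hr : pauliCorr Φ.toMap LinearMap.id =
      1 / 6 * ∑ a, ∑ i, ∑ j, Φ.toMap (pauli a) i j * pauli a j i := rfl
  rw [hf, hr]
  simp only [Fin.sum_univ_three, Fin.sum_univ_two, e0, e1, e2, map_add, map_sub, map_smul,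
    Matrix.add_apply, Matrix.sub_apply, Matrix.smul_apply, smul_eq_mul]
  simp [Matrix.trace, Fin.sum_univ_two] at t0 t1 ⊢
  linear_combination (1 / 2 : ℂ) * t0 + (1 / 2 : ℂ) * t1 + (1 / 2 : ℂ) *
    (Φ.toMap (Matrix.single 0 1 1) 0 1 + Φ.toMap (Matrix.single 1 0 1) 1 0 -
      Φ.toMap (Matrix.single 1 0 1) 0 1 - Φ.toMap (Matrix.single 0 1 1) 1 0) * Complex.I_sq

/-! ### The probability of acceptance -/

theorem trace_rounds (D : Devices) {k : ℕ} (c : Fin k → Cliff) (A : QMat) :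
    (rounds D k (fun j => (c j).val) A).trace = A.trace := by
  induction k with
  | zero => rfl
  | succ k ih =>
    rw [rounds_succ, LinearMap.comp_apply, LinearMap.comp_apply, Cliff.trace_map,
      (D.noise k).tracePreserving]
    exact ih fun j => c j.castSucc

theorem rounds_ideal_one {k : ℕ} (c : Fin k → Cliff) :
    rounds Devices.ideal k (fun j => (c j).val) 1 = 1 := by
  induction k with
  | zero => rfl
  | succ k ih =>
    rw [rounds_succ, LinearMap.comp_apply, LinearMap.comp_apply, ih fun j => c j.castSucc]
    exact Cliff.map_one _

/-- Summing over the two signs cancels the cross terms. Unitality is needed for the ideal map only,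
so the noise may be non-unital. -/
theorem sum_trace_pauliState (Φ Ψ : QMap) (hΦ : ∀ A : QMat, (Φ A).trace = A.trace)
    (hΨ : Ψ 1 = 1) :
    ∑ x, (Φ (pauliState x) * Ψ (pauliState x)).trace = 3 + 3 * pauliCorr Φ Ψ := by
  have h1 : (Φ 1).trace = 2 := by rw [hΦ]; simp
  have h (a : Fin 3) : ∑ s, (Φ (pauliState (a, s)) * Ψ (pauliState (a, s))).trace =
      1 + 1 / 2 * (Φ (pauli a) * Ψ (pauli a)).trace := by
    simp only [Fintype.sum_bool, pauliState, if_true, Bool.false_eq_true, if_false, map_smul,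
      map_add, hΨ, Matrix.smul_mul, Matrix.mul_smul, Matrix.add_mul, Matrix.mul_add,
      Matrix.trace_smul, Matrix.trace_add, Matrix.mul_one, smul_eq_mul, h1, hΦ, trace_pauli]
    ring
  rw [Fintype.sum_prod_type]
  simp only [h, Finset.sum_add_distrib, ← Finset.mul_sum, pauliCorr]
  simp
  ring

/-- A record of the test consists of the gates, the state and the outcome. -/
def executionEquiv (κ : ℕ) : Execution κ ≃ (Fin κ → Cliff) × (Fin 3 × Bool) × Bool where
  toFun e := (e.gates, e.state, e.accept)
  invFun x := ⟨x.1, x.2.1, x.2.2⟩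
  left_inv _ := rfl
  right_inv _ := rfl

instance (κ : ℕ) : Fintype (Execution κ) := Fintype.ofEquiv _ (executionEquiv κ).symm

instance (κ : ℕ) : MeasurableSingletonClass (Execution κ) := ⟨fun _ => trivial⟩

theorem card_cliff_pos : (0 : ℝ) < Nat.card Cliff := by
  have := four_le_card_cliff
  exact_mod_cast (by omega : 0 < Nat.card Cliff)

/-- The probability that an execution of depth `κ` is accepted. -/
def acceptProb (D : Devices) (κ : ℕ) : ℝ :=
  ∑ e : Execution κ, execProb D e * if e.accept then 1 else 0

theorem acceptProb_eq (D : Devices) (κ : ℕ) : acceptProb D κ =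
    (1 + (∏ j ∈ Finset.range κ, pauliCorr (D.noise j).toMap LinearMap.id).re) / 2 := by
  have hc := card_cliff_pos
  have h (c : Fin κ → Cliff) : ∑ x, execProb D (κ := κ) ⟨c, x, true⟩ =
      1 / (Nat.card Cliff : ℝ) ^ κ * (1 / 6) * (3 + 3 * (pauliCorr (rounds D κ fun j => (c j).val)
        (rounds Devices.ideal κ fun j => (c j).val)).re) := by
    simp only [execProb, povm, if_true, ← Finset.mul_sum, ← Complex.re_sum]
    rw [sum_trace_pauliState _ _ (trace_rounds D c) (rounds_ideal_one c)]
    simp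
  have hre := congrArg Complex.re (sum_pauliCorr_rounds D κ)
  have hpow : ((Nat.card Cliff : ℂ) ^ κ) = (((Nat.card Cliff : ℝ) ^ κ : ℝ) : ℂ) := by push_cast; rfl
  rw [hpow, Complex.re_ofReal_mul, Complex.re_sum] at hre
  have hs (f : (Fin κ → Cliff) × (Fin 3 × Bool) × Bool → ℝ) :
      ∑ y, f y = ∑ c, ∑ x, ∑ b, f (c, x, b) := by
    rw [Fintype.sum_prod_type]
    exact Finset.sum_congr rfl fun c _ => Fintype.sum_prod_type _
  rw [acceptProb, ← (executionEquiv κ).symm.sum_comp, hs]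
  simp only [executionEquiv, Equiv.coe_fn_symm_mk, Fintype.sum_bool, if_true, Bool.false_eq_true,
    if_false, mul_one, mul_zero, add_zero, h, ← Finset.mul_sum,
    Finset.sum_add_distrib, hre, Finset.sum_const, Finset.card_univ,
    ← Nat.card_eq_fintype_card, Nat.card_fun, Nat.card_fin, nsmul_eq_mul, Nat.cast_pow]
  field_simp
  ring

/-! ### Concentration of the winning rate -/

theorem integral_accept {Ω : Type*} [MeasurableSpace Ω] {μ : Measure Ω} [IsProbabilityMeasure μ]
    {D : Devices} {N : ℕ} {depth : Fin N → ℕ} {X : (i : Fin N) → Ω → Execution (depth i)}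
    (hX : IsTestRun μ D depth X) (i : Fin N) :
    ∫ ω, (if (X i ω).accept then (1 : ℝ) else 0) ∂μ = acceptProb D (depth i) := by
  have hm := hX.measurable i
  have := Measure.isProbabilityMeasure_map (μ := μ) hm.aemeasurable
  rw [← integral_map (φ := X i) (f := fun e => if e.accept then (1 : ℝ) else 0) hm.aemeasurable
    measurable_from_top.aestronglyMeasurable, integral_fintype (Integrable.of_finite)]
  refine Finset.sum_congr rfl fun e _ => ?_
  rw [map_measureReal_apply hm (measurableSet_singleton e), hX.law, smul_eq_mul]

theorem measure_winRate_ge_le {Ω : Type*} [MeasurableSpace Ω] {μ : Measure Ω}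
    [IsProbabilityMeasure μ] {D : Devices} {N : ℕ} {depth : Fin N → ℕ}
    {X : (i : Fin N) → Ω → Execution (depth i)} (hX : IsTestRun μ D depth X) {k : ℕ}
    (hk : 0 < numExec depth k) {ε : ℝ} (hε : 0 < ε) :
    μ.real {ω | acceptProb D k + ε ≤ winRate depth k fun i => X i ω} ≤
      Real.exp (-2 * (numExec depth k : ℝ) * ε ^ 2) := by
  set n : ℝ := (numExec depth k : ℝ) with hn
  have hn0 : 0 < n := Nat.cast_pos.2 hk
  let Y : (i : Fin N) → Ω → ℝ := fun i ω =>
    (if (X i ω).accept then 1 else 0) - acceptProb D (depth i)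
  have hindep : iIndepFun Y μ := hX.indep.comp
    (fun i e => (if e.accept then (1 : ℝ) else 0) - acceptProb D (depth i))
    fun i => measurable_from_top
  have hsub (i : Fin N) : HasSubgaussianMGF (Y i) ((‖(1 : ℝ) - 0‖₊ / 2) ^ 2) μ := by
    have hm : Measurable fun ω => if (X i ω).accept then (1 : ℝ) else 0 :=
      (measurable_from_top (f := fun e : Execution (depth i) =>
        if e.accept then (1 : ℝ) else 0)).comp (hX.measurable i)
    have := hasSubgaussianMGF_of_mem_Icc (μ := μ) (a := 0) (b := 1) hm.aemeasurable
      (Filter.Eventually.of_forall fun ω => by split_ifs <;> simp)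
    rwa [integral_accept hX i] at this
  have h := HasSubgaussianMGF.measure_sum_ge_le_of_iIndepFun hindep
    (s := Finset.univ.filter fun i => depth i = k) (fun i _ => hsub i) (ε := n * ε) (by positivity)
  -- A variable with values in `[0, 1]` has sub-Gaussian parameter `1/4`, so the `n` executions of
  -- depth `k` contribute `n / 4`.
  have hexp : -(n * ε) ^ 2 / (2 * ((∑ i ∈ Finset.univ.filter fun i => depth i = k,
      (‖(1 : ℝ) - 0‖₊ / 2) ^ 2 : NNReal) : ℝ)) = -2 * n * ε ^ 2 := by
    simp only [Finset.sum_const, nsmul_eq_mul, NNReal.coe_mul, NNReal.coe_natCast]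
    rw [← numExec, ← hn]
    simp
    field_simp
  rw [hexp] at h
  refine le_trans (measureReal_mono fun ω hω => ?_) h
  simp only [Set.mem_ofPred_eq, winRate, ← hn] at hω ⊢
  have hsum : ∑ i ∈ Finset.univ.filter (fun i => depth i = k), acceptProb D (depth i) =
      n * acceptProb D k := by
    rw [Finset.sum_congr rfl (g := fun _ => acceptProb D k)
      fun i hi => by rw [(Finset.mem_filter.1 hi).2], Finset.sum_const, nsmul_eq_mul, ← numExec]
  rw [le_div_iff₀ hn0] at hω
  simp only [Y, Finset.sum_sub_distrib, hsum]
  linarith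

theorem winRate_le_one {N : ℕ} (depth : Fin N → ℕ) (k : ℕ)
    (e : (i : Fin N) → Execution (depth i)) : winRate depth k e ≤ 1 := by
  refine div_le_one_of_le₀ ?_ (Nat.cast_nonneg _)
  refine (Finset.sum_le_sum (g := fun _ => (1 : ℝ)) fun i _ => by split_ifs <;> simp).trans ?_
  simp [numExec]

/-! ### From acceptance to the diamond distance -/

theorem diamondDist_le {Φ Ψ : QMap} {x : ℝ} (hx : 0 ≤ x)
    (h : ∀ (m : ℕ) (ρ : BiMat m), IsDensity ρ → DiffBound (ampl Φ m ρ - ampl Ψ m ρ) x) :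
    diamondDist Φ Ψ ≤ x := by
  refine Real.sSup_le ?_ hx
  rintro _ ⟨m, ρ, hρ, rfl⟩
  exact traceNorm_le_of_diffBound (h m ρ hρ)

/-- All factors have modulus at most one, so each modulus is at least the product; a negative factor
would have modulus at most `1/3 < t`. -/
theorem le_of_le_prod {ι : Type*} (s : Finset ι) {r : ι → ℝ} {t : ℝ} (ht : 1 / 3 < t)
    (h1 : ∀ j ∈ s, -(1 / 3) ≤ r j) (h2 : ∀ j ∈ s, r j ≤ 1) (h : t ≤ ∏ j ∈ s, r j) {j : ι}
    (hj : j ∈ s) : t ≤ r j := by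
  classical
  have habs (i : ι) (hi : i ∈ s) : |r i| ≤ 1 := abs_le.2 ⟨by linarith [h1 i hi], h2 i hi⟩
  have : t ≤ |r j| := by
    refine h.trans ((le_abs_self _).trans ?_)
    rw [Finset.abs_prod, ← Finset.mul_prod_erase s _ hj]
    exact mul_le_of_le_one_right (abs_nonneg _) (Finset.prod_le_one (fun _ _ => abs_nonneg _)
      fun i hi => habs i (Finset.mem_of_mem_erase hi))
  rcases le_abs.1 this with h | h
  · exact h
  · linarith [h1 j hj]

theorem QChannel.pauliCorr_eq_re (Φ : QChannel) :
    pauliCorr Φ.toMap LinearMap.id = ((pauliCorr Φ.toMap LinearMap.id).re : ℂ) := by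
  have h := (Complex.le_def.1 Φ.entFidelity_nonneg).2
  rw [Φ.entFidelity_eq] at h
  refine Complex.ext rfl ?_
  simp at h
  simpa using h

theorem QChannel.entFidelity_re (Φ : QChannel) :
    (entFidelity Φ.toMap).re = 1 + 3 * (pauliCorr Φ.toMap LinearMap.id).re := by
  simp [Φ.entFidelity_eq]

theorem four_mul_sq_le_four_pow (k : ℕ) : 4 * k ^ 2 ≤ 4 ^ k := by
  have h : 2 * k ≤ 2 ^ k := by
    rcases k with _ | k
    · simp
    · rw [pow_succ, mul_comm]
      exact Nat.mul_le_mul_right 2 Nat.lt_two_pow_self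
  calc 4 * k ^ 2 = (2 * k) ^ 2 := by ring
    _ ≤ (2 ^ k) ^ 2 := Nat.pow_le_pow_left h 2
    _ = 4 ^ k := by rw [← pow_mul, mul_comm, pow_mul]; norm_num

theorem diamondDist_protocol_le (D : Devices) {k : ℕ} {a : ℝ} (ha : 0 < a)
    (h : 1 - acceptProb D k ≤ a) (U : Fin k → Matrix.unitaryGroup (Fin 2) ℂ) :
    diamondDist (protocol D U) (protocol Devices.ideal U) ≤
      2 * √6 * √((Nat.card Cliff : ℝ) ^ k * a) := by
  have hcard : (4 : ℝ) * k ^ 2 ≤ (Nat.card Cliff : ℝ) ^ k := by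
    exact_mod_cast (four_mul_sq_le_four_pow k).trans (Nat.pow_le_pow_left four_le_card_cliff k)
  have hcard1 : (1 : ℝ) ≤ (Nat.card Cliff : ℝ) ^ k := by
    refine one_le_pow₀ ?_
    have := four_le_card_cliff
    exact_mod_cast (by omega : 1 ≤ Nat.card Cliff)
  set n := (Nat.card Cliff : ℝ) ^ k
  have hrhs : 2 * √6 * √(n * a) = √(24 * (n * a)) := by
    rw [show (24 : ℝ) * (n * a) = 2 ^ 2 * (6 * (n * a)) by ring,
      Real.sqrt_mul (x := 2 ^ 2) (by norm_num), Real.sqrt_sq (x := 2) (by norm_num),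
      Real.sqrt_mul (x := 6) (by norm_num), mul_assoc]
  rw [hrhs]
  refine diamondDist_le (Real.sqrt_nonneg _) fun m ρ hρ => ?_
  rcases le_or_gt 1 (6 * (n * a)) with hbig | hsmall
  · exact (diffBound_protocol_le_two D U hρ).mono (Real.le_sqrt_of_sq_le (by linarith))
  · have ha6 : 6 * a < 1 := by nlinarith
    set r : ℕ → ℝ := fun j => (pauliCorr (D.noise j).toMap LinearMap.id).re with hr
    have hprod : 1 - 2 * a ≤ ∏ j ∈ Finset.range k, r j := by
      rw [acceptProb_eq, Finset.prod_congr rfl fun j _ => (D.noise j).pauliCorr_eq_re,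
        ← Complex.ofReal_prod, Complex.ofReal_re] at h
      linarith
    -- The choice `η² = 3a/2` solves `1 + 3 (1 - 2a) = 4 - 4η²`.
    have hη : √(3 / 2 * a) ^ 2 = 3 / 2 * a := Real.sq_sqrt (by positivity)
    refine (diffBound_protocol_of_noise D U (x := 8 * √(3 / 2 * a)) (fun j hj ρ hρ => ?_) hρ).mono ?_
    · have hj' := le_of_le_prod (Finset.range k) (r := r) (by linarith)
        (fun j _ => by
          have := (Complex.le_def.1 (D.noise j).entFidelity_nonneg).1
          rw [(D.noise j).entFidelity_re, Complex.zero_re] at this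
          simp only [hr]
          linarith)
        (fun j _ => by
          have := (D.noise j).entFidelity_re_le
          rw [(D.noise j).entFidelity_re] at this
          simp only [hr]
          linarith) hprod (Finset.mem_range.2 hj)
      refine (D.noise j).diffBound_ampl_sub (Real.sqrt_pos.2 (by positivity)) ?_ ?_ hρ
      · rw [Real.sqrt_le_one]
        linarith
      · rw [hη, (D.noise j).entFidelity_re]
        simp only [hr] at hj'
        linarith
    · refine Real.le_sqrt_of_sq_le ?_
      rw [mul_pow, mul_pow, hη]
      -- The square of the left side is `96 k² a = 24 · 4 k² · a`, which `hcard` bounds.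
      nlinarith

end PingPong

end

theorem mainTheorem3 {Ω : Type*} [MeasurableSpace Ω] (μ : Measure Ω) [IsProbabilityMeasure μ]
    (D : PingPong.Devices) {N : ℕ} (depth : Fin N → ℕ)
    (X : (i : Fin N) → Ω → PingPong.Execution (depth i))
    (hX : PingPong.IsTestRun μ D depth X)
    (k : ℕ) (hk : 0 < PingPong.numExec depth k) (ε : ℝ) (hε : 0 < ε) :
    1 - Real.exp (-2 * (PingPong.numExec depth k : ℝ) * ε ^ 2) ≤
      μ.real {ω | ∀ U : Fin k → Matrix.unitaryGroup (Fin 2) ℂ,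
        PingPong.diamondDist (PingPong.protocol D U)
            (PingPong.protocol PingPong.Devices.ideal U) ≤
          2 * √6 * √((Nat.card PingPong.Cliff : ℝ) ^ k *
            (1 - PingPong.winRate depth k (fun i => X i ω) + ε))} := by
  set B := {ω | PingPong.acceptProb D k + ε ≤ PingPong.winRate depth k fun i => X i ω} with hB
  have h := PingPong.measure_winRate_ge_le hX hk hε
  set S := {ω | ∀ U : Fin k → Matrix.unitaryGroup (Fin 2) ℂ,
    PingPong.diamondDist (PingPong.protocol D U) (PingPong.protocol PingPong.Devices.ideal U) ≤
      2 * √6 * √((Nat.card PingPong.Cliff : ℝ) ^ k *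
        (1 - PingPong.winRate depth k (fun i => X i ω) + ε))} with hS
  -- Covering the space and using subadditivity avoids any measurability claim for `S`, which is an
  -- intersection over uncountably many gate choices.
  have hcover : Set.univ ⊆ B ∪ S := fun ω _ => by
    by_cases hω : ω ∈ B
    · exact Or.inl hω
    · refine Or.inr fun U => PingPong.diamondDist_protocol_le D ?_ ?_ U
      · linarith [PingPong.winRate_le_one depth k fun i => X i ω]
      · simp only [hB, Set.mem_ofPred_eq, not_le] at hω
        linarith
  have h1 := (measureReal_mono (μ := μ) hcover).trans (measureReal_union_le B S)
  rw [probReal_univ] at h1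
  linarith
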